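/- Conventions. A pair of jointly distributed random variables $X\in\{0,1\}^n$, $Z\in\{0,1\}^m$ has conditional min-entropy $\mathbf{H}_\infty(X|Z)\ge k$ if $\Pr[X=x\mid Z=z]\le 2^{-k}$ for all $x$ and all $z$ with $\Pr[Z=z]>0$. It has smooth conditional min-entropy $\mathbf{H}^{\delta}_\infty(X|Z)\ge k$ if there is a pair $(Y,Z')$ on $\{0,1\}^n\times\{0,1\}^m$ at statistical distance $\frac12\sum_{x,z}|\Pr[(X,Z)=(x,z)]-\Pr[(Y,Z')=(x,z)]|\le\delta$ from $(X,Z)$ with $\mathbf{H}_\infty(Y|Z')\ge k$; and $\mathbf{H}^{\delta}_\infty(X|Z)\le b$ means that $\mathbf{H}^{\delta}_\infty(X|Z)\ge t$ holds for no $t>b$. For real $s$, it has metric conditional min-entropy $\mathbf{H}^{\mathrm{Metric},\det[0,1],s,\epsilon}(X|Z)\ge k$ if for every deterministic $[0,1]$-valued circuit $D$ of size at most $s$ on $n+m$ input bits there is a pair $(Y,Z)$ with the same distribution of $Z$ such that $\mathbf{H}_\infty(Y|Z)\ge k$ and $|\mathbf{E}D(X,Z)-\mathbf{E}D(Y,Z)|\le\epsilon$.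 Circuits have gates of fan-in two computing arbitrary binary Boolean operations; the size is the number of vertices, the $n+m$ input vertices included; a $[0,1]$-valued circuit outputs the binary digits of its value $b_0.b_1\cdots b_r\in[0,1]$, for any $r\ge 0$. Theorem. There are an absolute constant $c>0$ and an $n_0$ such that for all integers $n\ge n_0$ and $m\ge 0$ and all real $C>0$, $0\le k<n-C$ and $\epsilon>0$ with $2^{k+m}\epsilon^2\ge 2$ there is a pair of jointly distributed random variables $X\in\{0,1\}^n$, $Z\in\{0,1\}^m$ such that (i) $\mathbf{H}^{1/2}_\infty(X|Z)\le k+1$, and (ii) $\mathbf{H}^{\mathrm{Metric},\det[0,1],s,\epsilon}(X|Z)\ge k+C$ for $s=c\cdot\dfrac{2^{k+m}\epsilon^4}{(k+m)\log_2\left(2^{k+m}\epsilon^2\right)}$. -/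

import Mathlib

open scoped BigOperators

noncomputable section

/-- Bit strings of length `n`. -/
abbrev Bits (n : ℕ) : Type := Fin n → Bool

/-! ### Information-theoretic notions

A pair of jointly distributed random variables `X ∈ {0,1}^n`, `Z ∈ {0,1}^m` is given by its joint
law, a `PMF (Bits n × Bits m)`. -/

/-- The expectation of `f` under a law on a finite set. -/
def expect {α : Type} [Fintype α] (P : PMF α) (f : α → ℝ) : ℝ :=
  ∑ a, (P a).toReal * f a

/-- Statistical distance `Δ(P, Q) = (1/2) ∑ₐ |P(a) - Q(a)|`. -/
def statDist {α : Type} [Fintype α] (P Q : PMF α) : ℝ :=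
  (1 / 2) * ∑ a, |(P a).toReal - (Q a).toReal|

/-- The law of `Z`, where `P` is the law of `(X, Z)`. -/
def condLaw {n m : ℕ} (P : PMF (Bits n × Bits m)) : PMF (Bits m) :=
  P.map Prod.snd

/-- Worst-case conditional min-entropy, `H_∞(X|Z) ≥ k`: for every value `z` that `Z` attains with
positive probability and every `x`, `Pr[X = x | Z = z] ≤ 2^{-k}`. -/
def CondMinEntropyAtLeast {n m : ℕ} (P : PMF (Bits n × Bits m)) (k : ℝ) : Prop :=
  ∀ z, condLaw P z ≠ 0 →
    ∀ x, (P (x, z)).toReal / (condLaw P z).toReal ≤ (2 : ℝ) ^ (-k)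

/-- Smooth conditional min-entropy, `H_∞^ε(X|Z) ≥ k`: some joint law at statistical distance at
most `ε` from that of `(X, Z)` has conditional min-entropy at least `k`. The law of the second
component may change too, so an upper bound on this entropy is also an upper bound on the
variant in which it is kept. -/
def SmoothCondMinEntropyAtLeast {n m : ℕ} (P : PMF (Bits n × Bits m)) (ε k : ℝ) : Prop :=
  ∃ Q : PMF (Bits n × Bits m), CondMinEntropyAtLeast Q k ∧ statDist P Q ≤ ε

/-- `H_∞^ε(X|Z) ≤ b`: the smooth conditional min-entropy is at least `t` for no `t > b`. -/
def SmoothCondMinEntropyAtMost {n m : ℕ} (P : PMF (Bits n × Bits m)) (ε b : ℝ) : Prop :=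
  ∀ t : ℝ, SmoothCondMinEntropyAtLeast P ε t → t ≤ b

/-- Metric conditional min-entropy at least `k` against the class `𝒟` with advantage `ε`: for
every `D ∈ 𝒟` there is a pair `(Y, Z)`, with the same `Z`, such that `H_∞(Y|Z) ≥ k` and
`|E D(X,Z) - E D(Y,Z)| ≤ ε`. -/
def MetricCondMinEntropyAtLeast {n m : ℕ} (P : PMF (Bits n × Bits m))
    (𝒟 : Set (Bits n × Bits m → ℝ)) (ε k : ℝ) : Prop :=
  ∀ D ∈ 𝒟, ∃ Q : PMF (Bits n × Bits m),
    condLaw Q = condLaw P ∧ CondMinEntropyAtLeast Q k ∧ |expect P D - expect Q D| ≤ ε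

/-! ### Circuits -/

/-- Boolean circuits with `N` input vertices and `v` vertices in all, the vertices listed in a
topological order: first the inputs, then the gates. A gate applies an arbitrary binary Boolean
operation to two earlier vertices (this includes constants, negation, conjunction and
disjunction). The size of the circuit is its number `v` of vertices. -/
inductive Circuit (N : ℕ) : ℕ → Type
  | inputs : Circuit N N
  | gate {v : ℕ} (c : Circuit N v) (op : Bool → Bool → Bool) (i j : Fin v) : Circuit N (v + 1)

/-- The bit computed at each vertex of the circuit. -/
def Circuit.eval {N : ℕ} : {v : ℕ} → Circuit N v → Bits N → Bits v
  | _, .inputs, w => w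
  | _, .gate c op i j, w => Fin.snoc (c.eval w) (op (c.eval w i) (c.eval w j))

/-- The number with binary expansion `b₀.b₁b₂…b_r`. -/
def binaryValue {r : ℕ} (b : Fin (r + 1) → Bool) : ℝ :=
  ∑ i, if b i then ((1 : ℝ) / 2) ^ (i : ℕ) else 0

/-- The functions on `{0,1}^n × {0,1}^m` computed by deterministic `[0,1]`-valued circuits of size
at most `s`: a circuit reads the `n + m` input bits, its output vertices give the digits of the
value in binary, and that value lies in `[0,1]` on every input. With a single output vertex
(`r = 0`) these are the Boolean circuits. -/
def realValuedCircuits (n m : ℕ) (s : ℝ) : Set (Bits n × Bits m → ℝ) :=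
  {D | ∃ (v : ℕ) (c : Circuit (n + m) v) (r : ℕ) (out : Fin (r + 1) → Fin v),
    (v : ℝ) ≤ s ∧
    (∀ p : Bits n × Bits m,
      D p = binaryValue (fun i => c.eval (Fin.append p.1 p.2) (out i))) ∧
    ∀ p, D p ∈ Set.Icc (0 : ℝ) 1}

end

open MeasureTheory ProbabilityTheory

/-! ### Expectations and uniform laws -/

/-! Let `Z` be uniform and, for each `z`, let `X` be uniform on a list of `K = ⌊2^k⌋` strings. A law
with conditional min-entropy `t > k + 1` gives these pairs mass at most `K * 2^(-t) < 1/2`, so it is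
not within distance `1/2`, whatever the lists (`smoothCondMinEntropyAtMost_sampleLaw`).

Random lists fool small circuits. A Boolean test has as its mean under this law an average over `2^m
* K` independent samples; by Hoeffding it misses the mean under the uniform law by `ε/2` with
probability exponentially small in `2^(k+m) * ε^2`. The union bound runs only over Boolean functions
at vertices of circuits of size `V`, at most `V^(4V) / 2` of them. Digit weights sum to at most two,
so error `ε/2` per vertex gives `ε` for `[0,1]`-valued outputs. The uniform law has conditional
min-entropy `n ≥ k + C`, which proves (ii). -/

lemma PMF.sum_toReal {α : Type} [Fintype α] (P : PMF α) : ∑ a, (P a).toReal = 1 := by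
  rw [← ENNReal.toReal_sum fun a _ => P.apply_ne_top a, ← tsum_fintype (L := .unconditional α),
    P.tsum_coe, ENNReal.toReal_one]

lemma PMF.map_apply_toReal {α β : Type} [Fintype α] [DecidableEq β] (P : PMF α) (g : α → β)
    (b : β) : (P.map g b).toReal = ∑ a, if b = g a then (P a).toReal else 0 := by
  classical
  rw [PMF.map_apply, tsum_fintype, ENNReal.toReal_sum]
  · refine Finset.sum_congr rfl fun a _ => ?_
    by_cases h : b = g a <;> simp [h]
  · intro a _
    split_ifs
    · exact P.apply_ne_top a
    · simp

lemma expect_map {α β : Type} [Fintype α] [Fintype β] (P : PMF α) (g : α → β) (f : β → ℝ) :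
    expect (P.map g) f = expect P fun a => f (g a) := by
  classical
  simp only [expect, PMF.map_apply_toReal, Finset.sum_mul, ite_mul, zero_mul]
  rw [Finset.sum_comm]
  simp

lemma expect_uniformOfFintype {α : Type} [Fintype α] [Nonempty α] (f : α → ℝ) :
    expect (PMF.uniformOfFintype α) f = (∑ a, f a) / Fintype.card α := by
  simp [expect, div_eq_inv_mul, Finset.mul_sum]

lemma expect_mem_Icc {α : Type} [Fintype α] (P : PMF α) {f : α → ℝ}
    (hf : ∀ a, f a ∈ Set.Icc (0 : ℝ) 1) : expect P f ∈ Set.Icc (0 : ℝ) 1 := by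
  refine ⟨Finset.sum_nonneg fun a _ => mul_nonneg ENNReal.toReal_nonneg (hf a).1, ?_⟩
  rw [← P.sum_toReal]
  exact Finset.sum_le_sum fun a _ => mul_le_of_le_one_right ENNReal.toReal_nonneg (hf a).2

lemma expect_sub_le_statDist {α : Type} [Fintype α] (P Q : PMF α) {f : α → ℝ}
    (hf : ∀ a, f a ∈ Set.Icc (0 : ℝ) 1) : expect P f - expect Q f ≤ statDist P Q := by
  -- Both laws have mass one, so `f` may be centred at `1/2`; then `|f - 1/2| ≤ 1/2` gives the
  -- factor in `statDist`.
  have h : expect P f - expect Q f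
      = ∑ a, ((P a).toReal - (Q a).toReal) * (f a - 1 / 2) := by
    simp only [expect, mul_sub, sub_mul, Finset.sum_sub_distrib, ← Finset.sum_mul,
      PMF.sum_toReal]
    ring
  rw [h, statDist, Finset.mul_sum]
  refine Finset.sum_le_sum fun a _ => (le_abs_self _).trans ?_
  rw [abs_mul, mul_comm]
  refine mul_le_mul_of_nonneg_right ?_ (abs_nonneg _)
  rw [abs_le]
  constructor <;> linarith [(hf a).1, (hf a).2]

lemma PMF.map_fst_uniformOfFintype (α β : Type) [Fintype α] [Fintype β] [Nonempty α]
    [Nonempty β] :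
    (PMF.uniformOfFintype (α × β)).map Prod.fst = PMF.uniformOfFintype α := by
  classical
  ext a
  rw [← ENNReal.toReal_eq_toReal_iff' (PMF.apply_ne_top _ _) (PMF.apply_ne_top _ _),
    PMF.map_apply_toReal, Fintype.sum_prod_type]
  simp

lemma PMF.map_snd_uniformOfFintype (α β : Type) [Fintype α] [Fintype β] [Nonempty α]
    [Nonempty β] :
    (PMF.uniformOfFintype (α × β)).map Prod.snd = PMF.uniformOfFintype β := by
  classical
  ext a
  rw [← ENNReal.toReal_eq_toReal_iff' (PMF.apply_ne_top _ _) (PMF.apply_ne_top _ _),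
    PMF.map_apply_toReal, Fintype.sum_prod_type]
  simp
  field_simp

lemma condMinEntropyAtLeast_uniform {n m : ℕ} {t : ℝ} (ht : t ≤ n) :
    CondMinEntropyAtLeast (PMF.uniformOfFintype (Bits n × Bits m)) t := by
  intro z _ x
  rw [condLaw, PMF.map_snd_uniformOfFintype]
  have h : ((2 : ℝ) ^ n)⁻¹ ≤ (2 : ℝ) ^ (-t) := by
    rw [← Real.rpow_natCast, ← Real.rpow_neg zero_le_two]
    exact Real.rpow_le_rpow_of_exponent_le one_le_two (by linarith)
  refine le_trans (le_of_eq ?_) h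
  simp
  field_simp

/-! ### The law of a sample -/

/-- The law of `(x (Z, J), Z)` for uniform and independent `Z` and `J`: given `Z = z`, the first
component is uniform on the list of samples `x (z, 0), …, x (z, K - 1)`. -/
noncomputable def sampleLaw {n m K : ℕ} [NeZero K] (x : Bits m × Fin K → Bits n) : PMF (Bits n × Bits m) :=
  (PMF.uniformOfFintype (Bits m × Fin K)).map fun p => (x p, p.1)

lemma condLaw_sampleLaw {n m K : ℕ} [NeZero K] (x : Bits m × Fin K → Bits n) :
    condLaw (sampleLaw x) = PMF.uniformOfFintype (Bits m) := by
  rw [condLaw, sampleLaw, PMF.map_comp]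
  exact PMF.map_fst_uniformOfFintype _ _

lemma CondMinEntropyAtLeast.apply_le {n m : ℕ} {Q : PMF (Bits n × Bits m)} {t : ℝ}
    (hQ : CondMinEntropyAtLeast Q t) (x : Bits n) (z : Bits m) :
    (Q (x, z)).toReal ≤ (2 : ℝ) ^ (-t) * (condLaw Q z).toReal := by
  by_cases hz : condLaw Q z = 0
  · have h : Q (x, z) = 0 := by
      by_contra h
      refine (PMF.mem_support_iff _ _).1 ?_ hz
      rw [condLaw, PMF.support_map]
      exact ⟨(x, z), (PMF.mem_support_iff _ _).2 h, rfl⟩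
    simp [h, hz]
  · exact (div_le_iff₀ (ENNReal.toReal_pos hz (PMF.apply_ne_top _ _))).1 (hQ z hz x)

lemma smoothCondMinEntropyAtMost_sampleLaw {n m K : ℕ} [NeZero K]
    (x : Bits m × Fin K → Bits n) {k : ℝ} (hK : (K : ℝ) ≤ (2 : ℝ) ^ k) :
    SmoothCondMinEntropyAtMost (sampleLaw x) (1 / 2) (k + 1) := by
  classical
  rintro t ⟨Q, hQ, hd⟩
  by_contra! ht
  set g : Bits m × Fin K → Bits n × Bits m := fun p => (x p, p.1)
  set f : Bits n × Bits m → ℝ := fun a => if a ∈ Set.range g then 1 else 0 with hf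
  have hP : expect (sampleLaw x) f = 1 := by
    have h : ∀ p, f (x p, p.1) = 1 := fun p => if_pos ⟨p, rfl⟩
    rw [sampleLaw, expect_map]
    simp only [h, expect, mul_one, PMF.sum_toReal]
  have hQf : expect Q f ≤ K * (2 : ℝ) ^ (-t) := by
    -- Repeated samples only increase the right-hand sum.
    calc expect Q f ≤ ∑ a, ∑ p, if a = g p then (Q a).toReal else 0 := by
          refine Finset.sum_le_sum fun a _ => ?_
          have hnn : ∀ p ∈ Finset.univ, 0 ≤ if a = g p then (Q a).toReal else 0 := by
            intro p _
            split_ifs <;> simp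
          by_cases ha : a ∈ Set.range g
          · obtain ⟨p, rfl⟩ := ha
            have := Finset.single_le_sum hnn (Finset.mem_univ p)
            simpa [hf] using this
          · simp only [hf, if_neg ha, mul_zero]
            exact Finset.sum_nonneg hnn
      _ = ∑ p, (Q (g p)).toReal := by
          rw [Finset.sum_comm]
          simp
      _ ≤ ∑ p : Bits m × Fin K, (2 : ℝ) ^ (-t) * (condLaw Q p.1).toReal :=
          Finset.sum_le_sum fun p _ => hQ.apply_le _ _
      -- The masses of the second marginal of `Q` sum to one, so it does not matter that this
      -- marginal may differ from that of the sample law.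
      _ = K * (2 : ℝ) ^ (-t) := by
          rw [Fintype.sum_prod_type]
          simp only [Finset.sum_const, Finset.card_univ, Fintype.card_fin, nsmul_eq_mul,
            ← Finset.mul_sum, PMF.sum_toReal, mul_one]
  have hlt : K * (2 : ℝ) ^ (-t) < 1 / 2 := by
    calc K * (2 : ℝ) ^ (-t) ≤ (2 : ℝ) ^ k * (2 : ℝ) ^ (-t) := by gcongr
      _ = (2 : ℝ) ^ (k - t) := by rw [← Real.rpow_add two_pos]; rfl
      _ < (2 : ℝ) ^ (-1 : ℝ) := Real.rpow_lt_rpow_of_exponent_lt one_lt_two (by linarith)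
      _ = 1 / 2 := by norm_num [Real.rpow_neg_one]
  have := expect_sub_le_statDist (sampleLaw x) Q (f := f) fun a => by
    simp only [hf]
    split_ifs <;> simp
  linarith

/-! ### Uniform samples and Hoeffding's inequality -/

/-- The test may vary with the index because a sample is judged together with its `z`. A general
interval of length one serves both tails, through `g` and `-g`. -/
lemma measureReal_pi_uniform_sum_ge_le {ι A : Type} [Fintype ι] [Fintype A] [Nonempty A]
    [MeasurableSpace A] [DiscreteMeasurableSpace A] (g : ι → A → ℝ) {a b : ℝ}
    (hab : b - a = 1) (hg : ∀ i x, g i x ∈ Set.Icc a b) {δ : ℝ} (hδ : 0 ≤ δ) :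
    (Measure.pi fun _ : ι => (PMF.uniformOfFintype A).toMeasure).real
        {ω | Fintype.card ι * δ ≤ ∑ i, (g i (ω i) - expect (PMF.uniformOfFintype A) (g i))}
      ≤ Real.exp (-(2 * Fintype.card ι * δ ^ 2)) := by
  set ν := (PMF.uniformOfFintype A).toMeasure
  have hmean : ∀ i, ∫ x, g i x ∂ν = expect (PMF.uniformOfFintype A) (g i) := fun i =>
    (PMF.integral_eq_sum _ _).trans rfl
  have hind : iIndepFun (fun i (ω : ι → A) => g i (ω i) - expect (PMF.uniformOfFintype A) (g i))
      (Measure.pi fun _ : ι => ν) :=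
    iIndepFun_pi (X := fun i x => g i x - expect (PMF.uniformOfFintype A) (g i))
      fun i => (measurable_of_finite _).aemeasurable
  have hsub : ∀ i ∈ Finset.univ, HasSubgaussianMGF
      (fun ω : ι → A => g i (ω i) - expect (PMF.uniformOfFintype A) (g i))
      ((‖b - a‖₊ / 2) ^ 2) (Measure.pi fun _ : ι => ν) := by
    intro i _
    have h := hasSubgaussianMGF_of_mem_Icc (μ := ν) (X := g i)
      (measurable_of_finite _).aemeasurable (Filter.Eventually.of_forall (hg i))
    rw [hmean] at h
    have hmp := measurePreserving_eval (fun _ : ι => ν) i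
    rw [← hmp.map_eq] at h
    exact h.of_map hmp.measurable.aemeasurable
  refine (HasSubgaussianMGF.measure_sum_ge_le_of_iIndepFun hind hsub (by positivity)).trans
    (le_of_eq ?_)
  congr 1
  rw [hab]
  -- For empty `ι` the quotient is `0 / 0 = 0`, which is the required exponent.
  rcases eq_or_ne (Fintype.card ι : ℝ) 0 with h0 | h0
  · simp [h0]
  · simp only [Finset.sum_const, Finset.card_univ, nsmul_eq_mul]
    push_cast
    simp only [norm_one]
    field_simp

/-- For a small enough family of `[0,1]`-valued tests some sample has all its empirical means
within `δ` of the true ones. -/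
lemma exists_sample_forall_abs_le {ι A : Type} [Fintype ι] [Fintype A] [Nonempty A]
    (F : Finset (ι → A → ℝ)) (hF : ∀ g ∈ F, ∀ i x, g i x ∈ Set.Icc (0 : ℝ) 1) {δ : ℝ}
    (hδ : 0 ≤ δ) (hcard : F.card * (2 * Real.exp (-(2 * Fintype.card ι * δ ^ 2))) < 1) :
    ∃ ω : ι → A, ∀ g ∈ F,
      |∑ i, (g i (ω i) - expect (PMF.uniformOfFintype A) (g i))| ≤ Fintype.card ι * δ := by
  let _ : MeasurableSpace A := ⊤
  set μ := Measure.pi fun _ : ι => (PMF.uniformOfFintype A).toMeasure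
  by_contra! hno
  set B : (ι → A → ℝ) → Set (ι → A) := fun g =>
    {ω | Fintype.card ι * δ ≤ ∑ i, (g i (ω i) - expect (PMF.uniformOfFintype A) (g i))}
  have hcover : (Set.univ : Set (ι → A)) ⊆ ⋃ g ∈ F, (B g ∪ B (-g)) := by
    intro ω _
    obtain ⟨g, hg, h⟩ := hno ω
    refine Set.mem_biUnion hg ?_
    rcases lt_abs.1 h with h | h
    · exact Or.inl h.le
    · refine Or.inr (h.le.trans_eq ?_)
      rw [← Finset.sum_neg_distrib]
      refine Finset.sum_congr rfl fun i _ => ?_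
      simp only [expect, Pi.neg_apply, mul_neg, Finset.sum_neg_distrib]
      ring
  have h1 : (1 : ℝ) ≤ F.card * (2 * Real.exp (-(2 * Fintype.card ι * δ ^ 2))) := by
    calc (1 : ℝ) = μ.real Set.univ := by simp
      _ ≤ μ.real (⋃ g ∈ F, (B g ∪ B (-g))) := measureReal_mono hcover (measure_ne_top _ _)
      _ ≤ ∑ g ∈ F, μ.real (B g ∪ B (-g)) := measureReal_biUnion_finset_le _ _
      _ ≤ ∑ g ∈ F, 2 * Real.exp (-(2 * Fintype.card ι * δ ^ 2)) := by
          refine Finset.sum_le_sum fun g hg => (measureReal_union_le _ _).trans ?_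
          rw [two_mul (Real.exp _)]
          refine add_le_add
            (measureReal_pi_uniform_sum_ge_le g (sub_zero 1) (hF g hg) hδ)
            (measureReal_pi_uniform_sum_ge_le (-g) (a := -1) (b := 0) (by norm_num) ?_ hδ)
          intro i x
          have := hF g hg i x
          exact ⟨neg_le_neg this.2, neg_nonpos.2 this.1⟩
      _ = _ := by simp
  linarith

/-- For a small enough family of Boolean tests some sample law is `δ`-indistinguishable from the
uniform law by all of them. -/
lemma exists_sampleLaw_forall_abs_le {n m K : ℕ} [NeZero K]
    (F : Finset (Bits n × Bits m → Bool)) {δ : ℝ} (hδ : 0 ≤ δ)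
    (hcard : F.card * (2 * Real.exp (-(2 * (2 ^ m * K) * δ ^ 2))) < 1) :
    ∃ x : Bits m × Fin K → Bits n, ∀ f ∈ F,
      |expect (sampleLaw x) (fun p => if f p then 1 else 0)
        - expect (PMF.uniformOfFintype (Bits n × Bits m)) (fun p => if f p then 1 else 0)| ≤ δ := by
  classical
  have hN : (Fintype.card (Bits m × Fin K) : ℝ) = 2 ^ m * K := by simp
  have hK : (0 : ℝ) < K := by exact_mod_cast Nat.pos_of_neZero K
  have hN0 : (0 : ℝ) < 2 ^ m * K := by positivity
  set G : (Bits n × Bits m → Bool) → Bits m × Fin K → Bits n → ℝ :=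
    fun f p x => if f (x, p.1) then 1 else 0 with hG
  obtain ⟨x, hx⟩ := exists_sample_forall_abs_le (F.image G)
    (by
      intro g hg p x
      obtain ⟨f, _, rfl⟩ := Finset.mem_image.1 hg
      simp only [hG]
      split_ifs <;> simp) hδ
    (by
      rw [hN]
      refine lt_of_le_of_lt ?_ hcard
      gcongr
      exact Finset.card_image_le)
  refine ⟨x, fun f hf => ?_⟩
  have h := hx _ (Finset.mem_image_of_mem G hf)
  rw [hN] at h
  -- Each `z` owns exactly `K` samples, so averaging the means of `f (·, z)` over all indices gives
  -- the mean under the uniform law on pairs.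
  have hkey : ∑ p, (G f p (x p) - expect (PMF.uniformOfFintype (Bits n)) (G f p))
      = (2 ^ m * K) * (expect (sampleLaw x) (fun p => if f p then 1 else 0)
        - expect (PMF.uniformOfFintype (Bits n × Bits m)) (fun p => if f p then 1 else 0)) := by
    rw [sampleLaw, expect_map, expect_uniformOfFintype, expect_uniformOfFintype, hN, mul_sub,
      mul_div_cancel₀ _ hN0.ne', Finset.sum_sub_distrib, Fintype.sum_prod_type_right (γ := ℝ)]
    congr 1
    simp only [expect_uniformOfFintype, Fintype.sum_prod_type, hG, ← Finset.sum_div]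
    rw [Finset.sum_comm (s := (Finset.univ : Finset (Bits n)))]
    simp
    field_simp
    rw [Finset.mul_sum]
  rw [hkey, abs_mul, abs_of_pos hN0] at h
  exact le_of_mul_le_mul_left h hN0

/-! ### Counting circuits -/

lemma Circuit.inputs_le_size {N v : ℕ} (c : Circuit N v) : N ≤ v := by
  induction c with
  | inputs => exact le_rfl
  | gate _ _ _ _ ih => exact ih.trans (Nat.le_succ _)

/-- Each new gate chooses one of 16 operations and two of at most `V` earlier vertices. -/
lemma Circuit.ncard_range_eval_le {N V : ℕ} (v : ℕ) (hv : v ≤ V) :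
    (Set.range (Circuit.eval : Circuit N v → Bits N → Bits v)).ncard ≤ (16 * V ^ 2) ^ v := by
  induction v with
  | zero =>
    rw [pow_zero]
    refine (Set.ncard_le_ncard (Set.subset_univ _)).trans ?_
    rw [Set.ncard_univ, Nat.card_eq_fintype_card]
    simp
  | succ v ih =>
    have hV : 0 < V := by omega
    -- With exactly `N` vertices there is no room for a gate.
    by_cases hN : N = v + 1
    · subst hN
      have h : Set.range (Circuit.eval : Circuit (v + 1) (v + 1) → _) ⊆ {id} := by
        rintro _ ⟨c, rfl⟩
        cases c with
        | inputs => rfl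
        | gate c _ _ _ => exact absurd c.inputs_le_size (by omega)
      refine (Set.ncard_le_ncard h).trans ?_
      rw [Set.ncard_singleton]
      exact Nat.one_le_pow _ _ (by positivity)
    · set E := Set.range (Circuit.eval : Circuit N v → Bits N → Bits v)
      have h : Set.range (Circuit.eval : Circuit N (v + 1) → _) ⊆
          (fun q : (Bits N → Bits v) × (Bool → Bool → Bool) × Fin v × Fin v =>
            fun w => (Fin.snoc (q.1 w) (q.2.1 (q.1 w q.2.2.1) (q.1 w q.2.2.2)) : Bits (v + 1))) ''
          (E ×ˢ Set.univ) := by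
        rintro _ ⟨c, rfl⟩
        cases c with
        | inputs => exact absurd rfl hN
        | gate c op i j => exact ⟨(c.eval, op, i, j), ⟨⟨c, rfl⟩, trivial⟩, rfl⟩
      refine (Set.ncard_le_ncard h).trans ((Set.ncard_image_le (Set.toFinite _)).trans ?_)
      rw [Set.ncard_prod, Set.ncard_univ, Nat.card_eq_fintype_card, pow_succ]
      refine Nat.mul_le_mul (ih (by omega)) ?_
      have hvV : v * v ≤ V * V := Nat.mul_le_mul (by omega) (by omega)
      simp
      nlinarith

/-- The Boolean functions computed at the vertices of circuits with at most `V` vertices. -/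
def vertexFunctions (N V : ℕ) : Set (Bits N → Bool) :=
  {f | ∃ v ≤ V, ∃ (c : Circuit N v) (i : Fin v), f = fun w => c.eval w i}

lemma ncard_vertexFunctions_le (N V : ℕ) :
    (vertexFunctions N V).ncard ≤ (V + 1) * (V * (16 * V ^ 2) ^ V) := by
  classical
  rcases Nat.eq_zero_or_pos V with rfl | hV
  · have h : vertexFunctions N 0 = ∅ := by
      refine Set.eq_empty_of_forall_notMem ?_
      rintro _ ⟨v, hv, c, i, rfl⟩
      exact absurd i.2 (by omega)
    simp [h]
  set S : ℕ → Set (Bits N → Bool) := fun v =>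
    (fun q : (Bits N → Bits v) × Fin v => fun w => q.1 w q.2) ''
      (Set.range (Circuit.eval : Circuit N v → _) ×ˢ Set.univ)
  have h : vertexFunctions N V ⊆ ⋃ v ∈ Finset.range (V + 1), S v := by
    rintro _ ⟨v, hv, c, i, rfl⟩
    exact Set.mem_biUnion (Finset.mem_coe.2 (Finset.mem_range.2 (by omega)))
      ⟨(c.eval, i), ⟨⟨c, rfl⟩, trivial⟩, rfl⟩
  refine (Set.ncard_le_ncard h).trans ((Finset.set_ncard_biUnion_le _ _).trans ?_)
  refine (Finset.sum_le_card_nsmul _ _ (V * (16 * V ^ 2) ^ V) fun v hv => ?_).trans_eq (by simp)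
  have hv' : v ≤ V := by simpa [Nat.lt_succ_iff] using hv
  refine (Set.ncard_image_le (Set.toFinite _)).trans ?_
  rw [Set.ncard_prod, Set.ncard_univ, Nat.card_eq_fintype_card, Fintype.card_fin, mul_comm]
  exact Nat.mul_le_mul hv' ((Circuit.ncard_range_eval_le v hv').trans
    (Nat.pow_le_pow_right (by positivity) hv'))

/-- The factor 2 pays for the two Hoeffding tails; `V ≥ 16` gives `16 * V^2 ≤ V^3`. -/
lemma two_mul_ncard_vertexFunctions_le {N V : ℕ} (hV : 16 ≤ V) :
    2 * (vertexFunctions N V).ncard ≤ V ^ (4 * V) := by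
  calc 2 * (vertexFunctions N V).ncard ≤ 2 * ((V + 1) * (V * (16 * V ^ 2) ^ V)) :=
        Nat.mul_le_mul_left _ (ncard_vertexFunctions_le N V)
    _ = (2 * (V + 1) * V) * (16 * V ^ 2) ^ V := by ring
    _ ≤ V ^ 3 * (V ^ 3) ^ V := by
        refine Nat.mul_le_mul ?_ (Nat.pow_le_pow_left ?_ V) <;> nlinarith [sq_nonneg V]
    _ = V ^ (3 + 3 * V) := by rw [← pow_mul, ← pow_add]
    _ ≤ V ^ (4 * V) := Nat.pow_le_pow_right (by omega) (by omega)

/-! ### Real-valued circuits -/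

/-- The digits of a real-valued circuit carry total weight at most two, so its advantage is at
most twice the largest advantage of its vertices. -/
lemma abs_expect_sub_le_of_realValuedCircuits {n m : ℕ} {s δ : ℝ}
    {P Q : PMF (Bits n × Bits m)} (hδ : 0 ≤ δ)
    (h : ∀ f ∈ vertexFunctions (n + m) ⌊s⌋₊,
      |expect P (fun p => if f (Fin.append p.1 p.2) then 1 else 0)
        - expect Q (fun p => if f (Fin.append p.1 p.2) then 1 else 0)| ≤ δ)
    {D : Bits n × Bits m → ℝ} (hD : D ∈ realValuedCircuits n m s) :
    |expect P D - expect Q D| ≤ 2 * δ := by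
  obtain ⟨v, c, r, out, hv, hDp, -⟩ := hD
  set f : Fin (r + 1) → Bits n × Bits m → ℝ := fun i p =>
    if c.eval (Fin.append p.1 p.2) (out i) then 1 else 0 with hf
  have hE : ∀ R : PMF (Bits n × Bits m),
      expect R D = ∑ i : Fin (r + 1), ((1 : ℝ) / 2) ^ (i : ℕ) * expect R (f i) := by
    intro R
    simp only [expect, hDp, binaryValue, Finset.mul_sum]
    rw [Finset.sum_comm]
    refine Finset.sum_congr rfl fun i _ => Finset.sum_congr rfl fun p _ => ?_
    simp only [hf]
    split_ifs <;> ring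
  rw [hE, hE, ← Finset.sum_sub_distrib]
  calc |∑ i : Fin (r + 1), (((1 : ℝ) / 2) ^ (i : ℕ) * expect P (f i)
          - ((1 : ℝ) / 2) ^ (i : ℕ) * expect Q (f i))|
      ≤ ∑ i : Fin (r + 1), ((1 : ℝ) / 2) ^ (i : ℕ) * δ := by
        refine (Finset.abs_sum_le_sum_abs _ _).trans (Finset.sum_le_sum fun i _ => ?_)
        rw [← mul_sub, abs_mul, abs_of_nonneg (by positivity)]
        exact mul_le_mul_of_nonneg_left
          (h _ ⟨v, Nat.le_floor hv, c, out i, rfl⟩) (by positivity)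
    _ ≤ 2 * δ := by
        rw [← Finset.sum_mul, Fin.sum_univ_eq_sum_range (fun i => ((1 : ℝ) / 2) ^ i)]
        exact mul_le_mul_of_nonneg_right (sum_geometric_two_le _) hδ

lemma metricCondMinEntropyAtLeast_of_forall {n m K : ℕ} [NeZero K] {s t ε : ℝ} (ht : t ≤ n)
    (x : Bits m × Fin K → Bits n)
    (h : ∀ D ∈ realValuedCircuits n m s,
      |expect (sampleLaw x) D - expect (PMF.uniformOfFintype (Bits n × Bits m)) D| ≤ ε) :
    MetricCondMinEntropyAtLeast (sampleLaw x) (realValuedCircuits n m s) ε t := by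
  -- One law, the uniform one, serves every `D`.
  refine fun D hD => ⟨PMF.uniformOfFintype _, ?_, condMinEntropyAtLeast_uniform ht, h D hD⟩
  rw [condLaw_sampleLaw, condLaw, PMF.map_snd_uniformOfFintype]

/-- With `M = 2^a` the size bound `V ≤ M ε⁴ / (32 a log₂ (M ε²))` beats the union bound. -/
lemma pow_mul_exp_lt_one {V : ℕ} {a ε : ℝ} (hV : 1 ≤ V) (hε : 0 < ε) (hε1 : ε < 1)
    (ha : 2 ≤ (2 : ℝ) ^ a * ε ^ 2)
    (hs : (V : ℝ) ≤ 1 / 32 * ((2 : ℝ) ^ a * ε ^ 4 /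
      (a * Real.logb 2 ((2 : ℝ) ^ a * ε ^ 2)))) :
    (V : ℝ) ^ (4 * V) * Real.exp (-((2 : ℝ) ^ a * ε ^ 2 / 4)) < 1 := by
  set M := (2 : ℝ) ^ a with hM
  have hM0 : 0 < M := Real.rpow_pos_of_pos two_pos a
  have hε2 : ε ^ 2 ≤ 1 := pow_le_one₀ hε.le hε1.le
  have ha1 : 1 ≤ a := by
    have : (2 : ℝ) ^ (1 : ℝ) ≤ (2 : ℝ) ^ a := by
      rw [Real.rpow_one]
      exact ha.trans (mul_le_of_le_one_right hM0.le hε2)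
    exact (Real.rpow_le_rpow_left_iff one_lt_two).1 this
  have hL : 1 ≤ Real.logb 2 (M * ε ^ 2) := by
    rw [Real.le_logb_iff_rpow_le one_lt_two (by positivity), Real.rpow_one]
    exact ha
  have hV0 : (0 : ℝ) < V := by exact_mod_cast hV
  -- Here `ε^2 ≤ 1` and a logarithm of at least one are given away. Together with `log V ≤ a` this
  -- makes `4 * V * log V` at most `M * ε^2 / 8`, half of what Hoeffding allows.
  have hVa : V * a ≤ M * ε ^ 2 / 32 := by
    have h1 : M * ε ^ 4 / (a * Real.logb 2 (M * ε ^ 2)) ≤ M * ε ^ 2 / a := by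
      refine div_le_div₀ (by positivity) ?_ (by linarith) (le_mul_of_one_le_right (by linarith) hL)
      have : ε ^ 4 = ε ^ 2 * ε ^ 2 := by ring
      rw [this]
      exact mul_le_mul_of_nonneg_left (mul_le_of_le_one_right (by positivity) hε2) hM0.le
    have h2 : (V : ℝ) ≤ M * ε ^ 2 / 32 / a := by
      refine hs.trans ((mul_le_mul_of_nonneg_left h1 (by norm_num)).trans_eq ?_)
      ring
    exact (le_div_iff₀ (by linarith)).1 h2
  have hVM : (V : ℝ) ≤ M := by
    have := mul_le_mul_of_nonneg_left hε2 hM0.le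
    nlinarith
  have hlog : Real.log V ≤ a := by
    calc Real.log V ≤ Real.log M := Real.log_le_log hV0 hVM
      _ = a * Real.log 2 := Real.log_rpow two_pos a
      _ ≤ a := mul_le_of_le_one_right (by linarith)
          ((Real.log_le_sub_one_of_pos two_pos).trans (by norm_num))
  have hpow : (V : ℝ) ^ (4 * V) = Real.exp (4 * V * Real.log V) := by
    rw [mul_comm _ (Real.log V), Real.exp_mul, Real.exp_log hV0, ← Real.rpow_natCast]
    push_cast
    rfl
  rw [hpow, ← Real.exp_add, Real.exp_lt_one_iff]
  have : V * Real.log V ≤ V * a := mul_le_mul_of_nonneg_left hlog hV0.le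
  have : 0 < M * ε ^ 2 := by positivity
  linarith

/-! ### Choice of parameters and the theorem -/

theorem mainTheorem2 :
    ∃ c : ℝ, 0 < c ∧ ∃ n₀ : ℕ, ∀ n : ℕ, n₀ ≤ n →
      ∀ (m : ℕ) (C k ε : ℝ), 0 < C → 0 ≤ k → k < n - C → 0 < ε →
        2 ≤ (2 : ℝ) ^ (k + m) * ε ^ 2 →
        ∃ P : PMF (Bits n × Bits m),
          SmoothCondMinEntropyAtMost P (1 / 2) (k + 1) ∧
          MetricCondMinEntropyAtLeast P
            (realValuedCircuits n m
              (c * ((2 : ℝ) ^ (k + m) * ε ^ 4 /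
                ((k + m) * Real.logb 2 ((2 : ℝ) ^ (k + m) * ε ^ 2)))))
            ε (k + C) := by
  refine ⟨1 / 32, by norm_num, 16, fun n hn m C k ε _ hk hkn hε hMε => ?_⟩
  set s := 1 / 32 * ((2 : ℝ) ^ (k + m) * ε ^ 4 /
    ((k + m) * Real.logb 2 ((2 : ℝ) ^ (k + m) * ε ^ 2)))
  have ht : k + C ≤ n := by linarith
  have h2k : (1 : ℝ) ≤ (2 : ℝ) ^ k := Real.one_le_rpow one_le_two hk
  have hK1 : 1 ≤ ⌊(2 : ℝ) ^ k⌋₊ := Nat.le_floor (by simpa using h2k)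
  set K := ⌊(2 : ℝ) ^ k⌋₊
  have hK1' : (1 : ℝ) ≤ K := by exact_mod_cast hK1
  have : NeZero K := ⟨by omega⟩
  have hK : (K : ℝ) ≤ (2 : ℝ) ^ k := Nat.floor_le (by linarith)
  have hK2 : (2 : ℝ) ^ k ≤ 2 * K := by linarith [Nat.lt_floor_add_one ((2 : ℝ) ^ k)]
  suffices ∃ x : Bits m × Fin K → Bits n, ∀ D ∈ realValuedCircuits n m s,
      |expect (sampleLaw x) D - expect (PMF.uniformOfFintype (Bits n × Bits m)) D| ≤ ε by
    obtain ⟨x, hx⟩ := this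
    exact ⟨sampleLaw x, smoothCondMinEntropyAtMost_sampleLaw x hK,
      metricCondMinEntropyAtLeast_of_forall ht x hx⟩
  -- For `ε ≥ 1` any sample works, as both expectations lie in `[0,1]`.
  rcases le_or_gt 1 ε with hε1 | hε1
  · refine ⟨fun _ _ => false, fun D hD => ?_⟩
    obtain ⟨v, c, r, out, -, -, hD01⟩ := hD
    have h1 := expect_mem_Icc (sampleLaw fun _ : Bits m × Fin K => fun _ : Fin n => false) hD01
    have h2 := expect_mem_Icc (PMF.uniformOfFintype (Bits n × Bits m)) hD01
    rw [abs_le]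
    constructor <;> linarith [h1.1, h1.2, h2.1, h2.2]
  -- A circuit has at least `n ≥ 16` vertices, so below this size the class is empty; this is the
  -- role of `n₀ = 16`.
  rcases lt_or_ge ⌊s⌋₊ 16 with hV | hV
  · refine ⟨fun _ _ => false, fun D hD => ?_⟩
    obtain ⟨v, c, r, out, hv, -, -⟩ := hD
    have := c.inputs_le_size
    have := Nat.le_floor hv
    omega
  classical
  set F : Finset (Bits n × Bits m → Bool) :=
    (vertexFunctions (n + m) ⌊s⌋₊).toFinite.toFinset.image fun f p => f (Fin.append p.1 p.2)
    with hF
  have hs0 : 0 ≤ s := by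
    by_contra! h
    rw [Nat.floor_of_nonpos h.le] at hV
    omega
  have hcard : F.card * (2 * Real.exp (-(2 * (2 ^ m * K) * (ε / 2) ^ 2))) < 1 := by
    have h1 : 2 * (F.card : ℝ) ≤ (⌊s⌋₊ : ℝ) ^ (4 * ⌊s⌋₊) := by
      have hle : F.card ≤ (vertexFunctions (n + m) ⌊s⌋₊).ncard := by
        rw [Set.ncard_eq_toFinset_card _ (vertexFunctions (n + m) ⌊s⌋₊).toFinite]
        exact Finset.card_image_le
      exact_mod_cast (Nat.mul_le_mul_left 2 hle).trans (two_mul_ncard_vertexFunctions_le hV)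
    -- Rounding `2^k` down to `K` loses at most a factor of two.
    have h2 : (2 : ℝ) ^ (k + m) * ε ^ 2 / 4 ≤ 2 * (2 ^ m * K) * (ε / 2) ^ 2 := by
      rw [Real.rpow_add two_pos, Real.rpow_natCast]
      have : (2 : ℝ) ^ k * (2 ^ m * ε ^ 2) ≤ 2 * K * (2 ^ m * ε ^ 2) := by gcongr
      linarith
    calc F.card * (2 * Real.exp (-(2 * (2 ^ m * K) * (ε / 2) ^ 2)))
        = 2 * F.card * Real.exp (-(2 * (2 ^ m * K) * (ε / 2) ^ 2)) := by ring
      _ ≤ (⌊s⌋₊ : ℝ) ^ (4 * ⌊s⌋₊) * Real.exp (-((2 : ℝ) ^ (k + m) * ε ^ 2 / 4)) := by gcongr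
      _ < 1 := pow_mul_exp_lt_one (by omega) hε hε1 hMε (Nat.floor_le hs0)
  obtain ⟨x, hx⟩ := exists_sampleLaw_forall_abs_le F (by positivity : 0 ≤ ε / 2) hcard
  refine ⟨x, fun D hD => ?_⟩
  have := abs_expect_sub_le_of_realValuedCircuits (by positivity : 0 ≤ ε / 2)
    (fun f hf => hx _ (Finset.mem_image_of_mem _ (by simpa using hf))) hD
  linarith
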